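/- Let $\mathcal M$ be a connected affine manifold of dimension $n$, i.e. a (Hausdorff, second countable) manifold with an atlas of charts into $\mathbb R^n$ all of whose coordinate changes are locally affine, and let $\nabla^{\mathcal M}$ be its natural flat torsion-free connection, the one obtained in each chart by pulling back the standard connection of $\mathbb R^n$. (For a locally Euclidean Riemannian manifold this is the Levi-Civita connection.) Let $\pi:\tilde{\mathcal M}\to\mathcal M$ be the universal cover, i.e. a simply connected covering space, with the smooth structure that makes $\pi$ a local diffeomorphism and with the pulled-back connection $\nabla^{\tilde{\mathcal M}}=\pi^\star\nabla^{\mathcal M}$. For $p,q\in\tilde{\mathcal M}$ let $\tilde\Pi_p^q:T_p\tilde{\mathcal M}\to T_q\tilde{\mathcal M}$ be the parallel transport of $\nabla^{\tilde{\mathcal M}}$ along a piecewise $C^1$ curve from $p$ to $q$ (it does not depend on the curve). Fix $p\in\tilde{\mathcal M}$. The developing map $\operatorname{dev}:\tilde{\mathcal M}\to T_p\tilde{\mathcal M}$ is \[ \operatorname{dev}(q)=\int_0^1\tilde\Pi_{\gamma(t)}^{p}(\dot\gamma(t))\,dt, \] where $\gamma:[0,1]\to\tilde{\mathcal M}$ is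 a piecewise $C^1$ curve from $p$ to $q$ (again the choice does not matter). **Theorem.** Let $\varphi$ be a deck transformation of $\tilde{\mathcal M}$, i.e. a homeomorphism $\varphi:\tilde{\mathcal M}\to\tilde{\mathcal M}$ with $\pi\circ\varphi=\pi$. Then there is an (invertible) affine transformation $m_\varphi\in\operatorname{Aff}(T_p\tilde{\mathcal M})$ such that \[ \operatorname{dev}(\varphi(q))=m_\varphi(\operatorname{dev}(q))\qquad\text{for all } q\in\tilde{\mathcal M}. \] Explicitly, $m_\varphi(v)=A_\varphi v+b_\varphi$ for $v\in T_p\tilde{\mathcal M}$, where \[ A_\varphi=\tilde\Pi_{\varphi(p)}^{p}\circ d\varphi_p\in\operatorname{End}(T_p\tilde{\mathcal M}),\qquad b_\varphi=\operatorname{dev}(\varphi(p))\in T_p\tilde{\mathcal M}. \] -/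

import Mathlib

open Set Filter Topology Manifold

open scoped ContDiff

noncomputable section

/-- Maps between subsets of `ℝⁿ` that near every point coincide with an affine map. -/
def affinePregroupoid (n : ℕ) : Pregroupoid (EuclideanSpace ℝ (Fin n)) where
  property f s := ∀ x ∈ s, ∃ A : EuclideanSpace ℝ (Fin n) →ᵃ[ℝ] EuclideanSpace ℝ (Fin n),
    f =ᶠ[𝓝 x] A
  comp := by
    intro f g u v hf hg _ _ _ x hx
    obtain ⟨A, hA⟩ := hf x hx.1
    obtain ⟨B, hB⟩ := hg (f x) hx.2
    have hAc : ContinuousAt f x :=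
      ((AffineMap.continuous_of_finiteDimensional A).continuousAt).congr hA.symm
    refine ⟨B.comp A, ?_⟩
    filter_upwards [hA, hAc.eventually hB] with y hy hy'
    simp only [Function.comp_apply, AffineMap.coe_comp]
    rw [hy', hy]
  id_mem := fun x _ => ⟨AffineMap.id ℝ _, Eventually.of_forall fun _ => rfl⟩
  locality := by
    intro f u _ h x hx
    obtain ⟨v, _, hxv, hv⟩ := h x hx
    exact hv x ⟨hx, hxv⟩
  congr := by
    intro f g u hu hfg hf x hx
    obtain ⟨A, hA⟩ := hf x hx
    refine ⟨A, ?_⟩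
    filter_upwards [hA, hu.mem_nhds hx] with y hy hyu
    rw [hfg y hyu, hy]

/-- The structure groupoid of locally affine local homeomorphisms of `ℝⁿ`. An affine manifold of
dimension `n` is a manifold modelled on `ℝⁿ` whose coordinate changes belong to it. -/
def affineGroupoid (n : ℕ) : StructureGroupoid (EuclideanSpace ℝ (Fin n)) :=
  (affinePregroupoid n).groupoid

section Affine

variable {n : ℕ} {M : Type*} [TopologicalSpace M] [ChartedSpace (EuclideanSpace ℝ (Fin n)) M]

/-- `w` is the covariant derivative at time `t`, within the time set `s`, of the vector field
along a curve `C : ℝ → TM`, for the natural connection `∇` of the affine manifold `M`. This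
connection is the pullback of the Euclidean connection by affine charts `κ`, so the condition is
`d/dt (dκ (C t)) = dκ w`. The chart `κ` is the preferred one at the base point of `C t`; since
coordinate changes are affine, any other chart of the atlas gives the same condition. -/
def HasCovDerivAlong (C : ℝ → TangentBundle 𝓘(ℝ, EuclideanSpace ℝ (Fin n)) M) (s : Set ℝ) (t : ℝ)
    (w : TangentSpace 𝓘(ℝ, EuclideanSpace ℝ (Fin n)) (C t).proj) : Prop :=
  let κ : M → EuclideanSpace ℝ (Fin n) := chartAt (EuclideanSpace ℝ (Fin n)) (C t).proj
  let dκ : TangentBundle 𝓘(ℝ, EuclideanSpace ℝ (Fin n)) M → EuclideanSpace ℝ (Fin n) := fun X =>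
    mfderiv 𝓘(ℝ, EuclideanSpace ℝ (Fin n)) 𝓘(ℝ, EuclideanSpace ℝ (Fin n)) κ X.proj X.2
  HasDerivWithinAt (fun r => dκ (C r)) (dκ ⟨(C t).proj, w⟩) s t

end Affine

section Cover

variable {n : ℕ}
  {M : Type*} [TopologicalSpace M] [ChartedSpace (EuclideanSpace ℝ (Fin n)) M]
  {N : Type*} [TopologicalSpace N] [ChartedSpace (EuclideanSpace ℝ (Fin n)) N]

/-- `γ`, restricted to `[0, 1]`, is a piecewise `C¹` curve from `p` to `q`. -/
def IsCurve (p q : N) (γ : ℝ → N) : Prop :=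
  γ 0 = p ∧ γ 1 = q ∧ ContinuousOn γ (Icc 0 1) ∧
    ∃ (k : ℕ) (τ : ℕ → ℝ), Monotone τ ∧ τ 0 = 0 ∧ τ k = 1 ∧
      ∀ i < k, ContMDiffOn 𝓘(ℝ, ℝ) 𝓘(ℝ, EuclideanSpace ℝ (Fin n)) 1 γ (Icc (τ i) (τ (i + 1)))

/-- The velocity `γ'(t)`. -/
def velocity (γ : ℝ → N) (t : ℝ) : TangentSpace 𝓘(ℝ, EuclideanSpace ℝ (Fin n)) (γ t) :=
  mfderiv 𝓘(ℝ, ℝ) 𝓘(ℝ, EuclideanSpace ℝ (Fin n)) γ t (1 : ℝ)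

/-- `w` is the covariant derivative at time `t`, within `s`, of the vector field `c` along a curve
in `N`, for the connection `π^* ∇`, where `∇` is the natural connection of the affine manifold
`M`: the field `dπ ∘ c` along the projected curve has covariant derivative `dπ w`. -/
def HasPullbackCovDerivAlong (π : N → M)
    (c : ℝ → TangentBundle 𝓘(ℝ, EuclideanSpace ℝ (Fin n)) N) (s : Set ℝ) (t : ℝ)
    (w : TangentSpace 𝓘(ℝ, EuclideanSpace ℝ (Fin n)) (c t).proj) : Prop :=
  HasCovDerivAlong
    (fun r => tangentMap 𝓘(ℝ, EuclideanSpace ℝ (Fin n)) 𝓘(ℝ, EuclideanSpace ℝ (Fin n)) π (c r)) s t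
    (mfderiv 𝓘(ℝ, EuclideanSpace ℝ (Fin n)) 𝓘(ℝ, EuclideanSpace ℝ (Fin n)) π (c t).proj w)

/-- `c` is a vector field along `γ` on `[0, 1]` that is parallel for the connection `π^* ∇`. -/
def IsParallelAlong (π : N → M) (γ : ℝ → N)
    (c : ℝ → TangentBundle 𝓘(ℝ, EuclideanSpace ℝ (Fin n)) N) : Prop :=
  ∀ t ∈ Icc (0 : ℝ) 1, (c t).proj = γ t ∧ HasPullbackCovDerivAlong π c (Icc 0 1) t 0

/-- The linear map `L : T_p N → T_q N` is the parallel transport along `γ`. -/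
def IsTransportAlong (π : N → M) (γ : ℝ → N) {p q : N}
    (L : TangentSpace 𝓘(ℝ, EuclideanSpace ℝ (Fin n)) p →ₗ[ℝ]
      TangentSpace 𝓘(ℝ, EuclideanSpace ℝ (Fin n)) q) : Prop :=
  ∀ v, ∃ c : ℝ → TangentBundle 𝓘(ℝ, EuclideanSpace ℝ (Fin n)) N,
    IsParallelAlong π γ c ∧ c 0 = ⟨p, v⟩ ∧ c 1 = ⟨q, L v⟩

/-- The parallel transport operator `Π_p^q : T_p N → T_q N` of a simply connected covering
manifold: the transport along some chosen piecewise `C¹` curve from `p` to `q`. -/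
def parallelTransport (π : N → M) (p q : N) :
    TangentSpace 𝓘(ℝ, EuclideanSpace ℝ (Fin n)) p →ₗ[ℝ]
      TangentSpace 𝓘(ℝ, EuclideanSpace ℝ (Fin n)) q :=
  Classical.epsilon fun L => ∃ γ : ℝ → N, IsCurve (n := n) p q γ ∧ IsTransportAlong π γ L

/-- The integral `∫₀¹ Π_{γ(t)}^p (γ'(t)) dt`, a vector of `T_p N`. -/
def transportIntegral (π : N → M) (p : N) (γ : ℝ → N) :
    TangentSpace 𝓘(ℝ, EuclideanSpace ℝ (Fin n)) p :=
  intervalIntegral (E := EuclideanSpace ℝ (Fin n))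
    (fun t => parallelTransport π (γ t) p (velocity γ t)) 0 1 MeasureTheory.volume

/-- The developing map `dev : N → T_p N` with base point `p`, the value at `q` being
`∫₀¹ Π_{γ(t)}^p (γ'(t)) dt` for some chosen piecewise `C¹` curve `γ` from `p` to `q`. -/
def developingMap (π : N → M) (p q : N) : TangentSpace 𝓘(ℝ, EuclideanSpace ℝ (Fin n)) p :=
  Classical.epsilon fun w => ∃ γ : ℝ → N, IsCurve (n := n) p q γ ∧ w = transportIntegral π p γ

/-- A deck transformation of `π : N → M`. -/
def IsDeckTransformation (π : N → M) (φ : N ≃ₜ N) : Prop :=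
  ∀ x, π (φ x) = π x

/-- The linear map `A_φ = Π_{φ(p)}^p ∘ dφ_p` of `T_p N`. -/
def monodromyLinear (π : N → M) (φ : N ≃ₜ N) (p : N) :
    Module.End ℝ (TangentSpace 𝓘(ℝ, EuclideanSpace ℝ (Fin n)) p) :=
  parallelTransport π (φ p) p ∘ₗ
    (mfderiv 𝓘(ℝ, EuclideanSpace ℝ (Fin n)) 𝓘(ℝ, EuclideanSpace ℝ (Fin n)) φ p).toLinearMap

end Cover

end

/-!
A simply connected cover `N` of an affine manifold `M` carries a *development*: a map `D : N → ℝⁿ`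
which near each point is an affine coordinate system of `M` composed with `π`
(`exists_isAffineDevelopment`). The germs of affine coordinate systems of `M` form a covering space
of `M`, because an affine map of `ℝⁿ` is determined by its germ at any point; a lift of `π` to this
covering space selects compatible germs along `N`, and `D` is obtained by evaluating them.

The differentials `Θ_x : T_x N → ℝⁿ` of `D` form a global parallel frame. In this frame the
covariant derivative is the ordinary derivative, so the transport along any curve from `p` to `q` is
`Θ_q⁻¹ ∘ Θ_p` (`IsAffineDevelopment.isTransportAlong_iff`). Hence the integrand defining `dev` is
`Θ_p⁻¹ (D ∘ γ)'`, and the fundamental theorem of calculus gives `dev q = Θ_p⁻¹ (D q - D p)` for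
every curve (`IsAffineDevelopment.frame_developingMap`). Any two points are joined by a piecewise
`C¹` curve (`exists_isCurve`), so the choices in the definitions of transport and of `dev` are made
among existing objects and do not affect the values.

If `φ` is a deck transformation, then `D ∘ φ` and `D` are locally affine in the same coordinates of
`M`, so that `D ∘ φ = m ∘ D` locally, and by connectedness globally, for an affine automorphism `m`
(`IsAffineDevelopment.exists_affineEquiv_deck`). Differentiating at `p` shows that the linear part
of `m`, read in the frame at `p`, is `A_φ` (`IsAffineDevelopment.frame_monodromyLinear`), and the
theorem follows from the formula for `dev`.
-/

noncomputable section

local notation "𝔼" n:max => EuclideanSpace ℝ (Fin n)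

local notation "𝓘𝔼" n:max => 𝓘(ℝ, EuclideanSpace ℝ (Fin n))

/-! ### Locally affine coordinate changes -/

section AffineCharts

variable {n : ℕ}

theorem AffineMap.eq_of_eventuallyEq {A B : 𝔼 n →ᵃ[ℝ] 𝔼 n} {x : 𝔼 n} (h : A =ᶠ[𝓝 x] B) :
    A = B := by
  obtain ⟨u, hu, huo, hxu⟩ := eventually_nhds_iff.1 h
  exact AffineMap.ext_on (huo.affineSpan_eq_top ⟨x, hxu⟩) hu

theorem AffineEquiv.eq_of_eventuallyEq {A B : 𝔼 n ≃ᵃ[ℝ] 𝔼 n} {x : 𝔼 n} (h : A =ᶠ[𝓝 x] B) :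
    A = B :=
  AffineEquiv.toAffineMap_injective (AffineMap.eq_of_eventuallyEq h)

variable {M : Type*} [TopologicalSpace M] [ChartedSpace (𝔼 n) M]

/-- An affine relation between the values of a chart near a point determines the affine map. -/
theorem AffineEquiv.eq_of_eventuallyEq_chart {a y : M} (hy : y ∈ (chartAt (𝔼 n) a).source)
    {A B : 𝔼 n ≃ᵃ[ℝ] 𝔼 n}
    (h : ∀ᶠ z in 𝓝 y, A (chartAt (𝔼 n) a z) = B (chartAt (𝔼 n) a z)) : A = B := by
  apply AffineEquiv.eq_of_eventuallyEq (x := chartAt (𝔼 n) a y)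
  rw [← (chartAt (𝔼 n) a).map_nhds_eq hy]
  exact h

theorem exists_affineEquiv_chart [HasGroupoid M (affineGroupoid n)] {a b y : M}
    (ha : y ∈ (chartAt (𝔼 n) a).source) (hb : y ∈ (chartAt (𝔼 n) b).source) :
    ∃ T : 𝔼 n ≃ᵃ[ℝ] 𝔼 n, ∀ᶠ z in 𝓝 y, chartAt (𝔼 n) b z = T (chartAt (𝔼 n) a z) := by
  have key : ∀ a b : M, y ∈ (chartAt (𝔼 n) a).source → y ∈ (chartAt (𝔼 n) b).source →
      ∃ A : 𝔼 n →ᵃ[ℝ] 𝔼 n, ∀ᶠ z in 𝓝 y, chartAt (𝔼 n) b z = A (chartAt (𝔼 n) a z) := by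
    intro a b ha hb
    have hG : (chartAt (𝔼 n) a).symm.trans (chartAt (𝔼 n) b) ∈ affineGroupoid n :=
      HasGroupoid.compatible (chart_mem_atlas _ a) (chart_mem_atlas _ b)
    obtain ⟨A, hA⟩ := (mem_groupoid_of_pregroupoid.1 hG).1 (chartAt (𝔼 n) a y) (by simp [ha, hb])
    refine ⟨A, ?_⟩
    filter_upwards [((chartAt (𝔼 n) a).continuousAt ha).eventually hA,
      (chartAt (𝔼 n) a).open_source.mem_nhds ha] with z hz hza
    simpa [hza] using hz
  obtain ⟨A, hA⟩ := key a b ha hb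
  obtain ⟨B, hB⟩ := key b a hb ha
  have hBA : B.comp A = AffineMap.id ℝ _ := by
    apply AffineMap.eq_of_eventuallyEq (x := chartAt (𝔼 n) a y)
    rw [← (chartAt (𝔼 n) a).map_nhds_eq ha]
    change ∀ᶠ z in 𝓝 y, B (A (chartAt (𝔼 n) a z)) = chartAt (𝔼 n) a z
    filter_upwards [hA, hB] with z h1 h2
    rw [← h1, ← h2]
  have hAB : A.comp B = AffineMap.id ℝ _ := by
    apply AffineMap.eq_of_eventuallyEq (x := chartAt (𝔼 n) b y)
    rw [← (chartAt (𝔼 n) b).map_nhds_eq hb]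
    change ∀ᶠ z in 𝓝 y, A (B (chartAt (𝔼 n) b z)) = chartAt (𝔼 n) b z
    filter_upwards [hA, hB] with z h1 h2
    rw [← h2, ← h1]
  refine ⟨AffineEquiv.ofBijective (φ := A) (Function.bijective_iff_has_inverse.2
    ⟨B, fun v => DFunLike.congr_fun hBA v, fun v => DFunLike.congr_fun hAB v⟩), ?_⟩
  exact hA

theorem isManifold_of_affineGroupoid [HasGroupoid M (affineGroupoid n)] :
    IsManifold (𝓘𝔼 n) ∞ M := by
  have hle : affineGroupoid n ≤ contDiffGroupoid ∞ (𝓘𝔼 n) := by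
    apply groupoid_of_pregroupoid_le
    intro f s hf x hx
    obtain ⟨A, hA⟩ := hf x (by simpa using hx)
    have hAs : ContDiff ℝ ∞ A :=
      (⟨A, AffineMap.continuous_of_finiteDimensional A⟩ : 𝔼 n →ᴬ[ℝ] 𝔼 n).contDiff
    exact (hAs.contDiffAt.congr_of_eventuallyEq hA).contDiffWithinAt
  have := hasGroupoid_of_le (M := M) ‹HasGroupoid M (affineGroupoid n)› hle
  exact IsManifold.mk' _ _ _

/-- The affine coordinate change from the chart at `a` to the chart at `b` near `y`. It is chosen
among the affine maps with this property, and is arbitrary unless `y` lies in both charts. -/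
def affineTransition (n : ℕ) {M : Type*} [TopologicalSpace M] [ChartedSpace (𝔼 n) M]
    (a b y : M) : 𝔼 n ≃ᵃ[ℝ] 𝔼 n :=
  Classical.epsilon fun T => ∀ᶠ z in 𝓝 y, chartAt (𝔼 n) b z = T (chartAt (𝔼 n) a z)

theorem affineTransition_spec [HasGroupoid M (affineGroupoid n)] {a b y : M}
    (ha : y ∈ (chartAt (𝔼 n) a).source) (hb : y ∈ (chartAt (𝔼 n) b).source) :
    ∀ᶠ z in 𝓝 y, chartAt (𝔼 n) b z = affineTransition n a b y (chartAt (𝔼 n) a z) :=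
  Classical.epsilon_spec (exists_affineEquiv_chart ha hb)

theorem affineTransition_eq [HasGroupoid M (affineGroupoid n)] {a b y : M}
    (ha : y ∈ (chartAt (𝔼 n) a).source) (hb : y ∈ (chartAt (𝔼 n) b).source)
    {T : 𝔼 n ≃ᵃ[ℝ] 𝔼 n} (hT : ∀ᶠ z in 𝓝 y, chartAt (𝔼 n) b z = T (chartAt (𝔼 n) a z)) :
    affineTransition n a b y = T := by
  apply AffineEquiv.eq_of_eventuallyEq_chart ha
  filter_upwards [hT, affineTransition_spec ha hb] with z h1 h2
  rw [← h1, ← h2]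

theorem eventually_affineTransition_eq [HasGroupoid M (affineGroupoid n)] {a b y : M}
    (ha : y ∈ (chartAt (𝔼 n) a).source) (hb : y ∈ (chartAt (𝔼 n) b).source) :
    ∀ᶠ z in 𝓝 y, affineTransition n a b z = affineTransition n a b y := by
  filter_upwards [eventually_eventually_nhds.2 (affineTransition_spec ha hb),
    (chartAt (𝔼 n) a).open_source.mem_nhds ha, (chartAt (𝔼 n) b).open_source.mem_nhds hb]
    with z hz hza hzb
  exact affineTransition_eq hza hzb hz

end AffineCharts

/-! ### The covering space of germs of affine coordinates -/

section Development

variable {n : ℕ} {M : Type*} [TopologicalSpace M] [ChartedSpace (𝔼 n) M]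

/-- The affine automorphisms of `ℝⁿ`, as a discrete space. -/
def DiscreteAffine (n : ℕ) : Type := 𝔼 n ≃ᵃ[ℝ] 𝔼 n

instance : TopologicalSpace (DiscreteAffine n) := ⊥

instance : DiscreteTopology (DiscreteAffine n) := ⟨rfl⟩

/-- The bundle over `M` whose points over `y` are the germs at `y` of affine coordinate systems:
relative to the chart `κ` at `a`, the germ of `A ∘ κ` is recorded as the affine automorphism `A`.
The coordinate change comes from `A ∘ κ_a = (A ∘ T) ∘ κ_b`, with `T` the transition from `κ_b` to
`κ_a`. The fibre is discrete, so that the bundle is a covering space of `M`. -/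
def affineGermBundle (n : ℕ) (M : Type*) [TopologicalSpace M] [ChartedSpace (𝔼 n) M]
    [HasGroupoid M (affineGroupoid n)] : FiberBundleCore M M (DiscreteAffine n) where
  baseSet a := (chartAt (𝔼 n) a).source
  isOpen_baseSet a := (chartAt (𝔼 n) a).open_source
  indexAt := id
  mem_baseSet_at a := mem_chart_source _ a
  coordChange a b y A := (affineTransition n b a y).trans A
  coordChange_self a y hy A := by
    have : affineTransition n a a y = AffineEquiv.refl ℝ _ :=
      affineTransition_eq hy hy (Eventually.of_forall fun _ => rfl)
    rw [this]
    exact AffineEquiv.refl_trans A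
  continuousOn_coordChange a b := by
    rintro ⟨y, A⟩ ⟨⟨ha, hb⟩, -⟩
    apply ContinuousAt.continuousWithinAt
    let T : DiscreteAffine n := (affineTransition n b a y).trans A
    refine ContinuousAt.congr (f := fun _ => T) continuousAt_const ?_
    have h1 : ∀ᶠ p : M × DiscreteAffine n in 𝓝 (y, A),
        affineTransition n b a p.1 = affineTransition n b a y :=
      continuousAt_fst.eventually (eventually_affineTransition_eq hb ha)
    have h2 : ∀ᶠ p : M × DiscreteAffine n in 𝓝 (y, A), p.2 ∈ ({A} : Set (DiscreteAffine n)) :=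
      continuousAt_snd.eventually_mem ((isOpen_discrete _).mem_nhds rfl)
    filter_upwards [h1, h2] with p hp1 hp2
    rw [hp1, mem_singleton_iff.1 hp2]
  coordChange_comp a b c y hy A := by
    have h : (affineTransition n c b y).trans (affineTransition n b a y) =
        affineTransition n c a y := by
      refine (affineTransition_eq hy.2 hy.1.1 ?_).symm
      filter_upwards [affineTransition_spec hy.2 hy.1.2, affineTransition_spec hy.1.2 hy.1.1]
        with z h1 h2
      rw [h2, h1, AffineEquiv.trans_apply]
    rw [← h]
    exact (AffineEquiv.trans_assoc _ _ _).symm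

variable {N : Type*} [TopologicalSpace N]

/-- `D` is locally an affine coordinate system of `M`, pulled back along `π`. Near `x₀` it is
compared with the preferred chart at `π x₀`; any other chart there differs by an affine map. -/
def IsAffineDevelopment (n : ℕ) {M : Type*} [TopologicalSpace M] [ChartedSpace (𝔼 n) M]
    (π : N → M) (D : N → 𝔼 n) : Prop :=
  ∀ x₀, ∃ A : 𝔼 n ≃ᵃ[ℝ] 𝔼 n, ∀ᶠ x in 𝓝 x₀, D x = A (chartAt (𝔼 n) (π x₀) (π x))

/-- Over a simply connected space the locally given affine coordinates fit together: lift `π` to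
the covering space of germs of affine coordinates and evaluate the germs. -/
theorem exists_isAffineDevelopment [HasGroupoid M (affineGroupoid n)] [SimplyConnectedSpace N]
    [LocallyPathConnectedSpace N] {π : N → M} (hπ : Continuous π) :
    ∃ D : N → 𝔼 n, IsAffineDevelopment n π D := by
  let Z := affineGermBundle n M
  obtain ⟨x₁⟩ : Nonempty N := inferInstance
  have hcov : IsCoveringMap (Bundle.TotalSpace.proj : Z.TotalSpace → M) :=
    FiberBundle.isCoveringMap (F := DiscreteAffine n)
  let e₁ : Z.TotalSpace := ⟨π x₁, (AffineEquiv.refl ℝ (𝔼 n) : DiscreteAffine n)⟩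
  obtain ⟨F, ⟨-, hF⟩, -⟩ := hcov.existsUnique_continuousMap_lifts ⟨π, hπ⟩ x₁ e₁ rfl
  have hF' : ∀ x, (F x).proj = π x := fun x => congrFun hF x
  -- A point over `y` is recorded relative to the chart at `y` itself, which evaluates its germ.
  let frame : Z.TotalSpace → 𝔼 n ≃ᵃ[ℝ] 𝔼 n := fun e => e.2
  refine ⟨fun x => frame (F x) (chartAt (𝔼 n) (F x).proj (F x).proj), fun x₀ => ?_⟩
  let A : 𝔼 n ≃ᵃ[ℝ] 𝔼 n := (Z.localTriv (π x₀) (F x₀)).2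
  have hsrc : F x₀ ∈ (Z.localTriv (π x₀)).source := by
    rw [Z.mem_localTriv_source, hF']
    exact mem_chart_source _ _
  have hcont : ContinuousAt (fun x => (Z.localTriv (π x₀) (F x)).2) x₀ :=
    continuousAt_snd.comp
      (((Z.localTriv (π x₀)).continuousAt hsrc).comp F.continuous.continuousAt)
  have hconst : ∀ᶠ x in 𝓝 x₀, (Z.localTriv (π x₀) (F x)).2 ∈ ({A} : Set (DiscreteAffine n)) :=
    hcont.eventually_mem ((isOpen_discrete _).mem_nhds rfl)
  refine ⟨A, ?_⟩
  filter_upwards [hconst,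
    hπ.continuousAt.eventually ((chartAt (𝔼 n) (π x₀)).open_source.mem_nhds (mem_chart_source _ _))]
    with x hx hxs
  have hx' : (affineTransition n (π x₀) (F x).proj (F x).proj).trans (frame (F x)) = A := hx
  rw [← hx', AffineEquiv.trans_apply, ← hF' x]
  rw [← (affineTransition_spec (by rw [hF']; exact hxs) (mem_chart_source _ _)).self_of_nhds]

end Development

/-! ### The differential of a development and parallel transport -/

section Transport

variable {n : ℕ} {M : Type*} [TopologicalSpace M] [ChartedSpace (𝔼 n) M]
  [HasGroupoid M (affineGroupoid n)]
  {N : Type*} [TopologicalSpace N] [ChartedSpace (𝔼 n) N]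
  {π : N → M} {D : N → 𝔼 n}

theorem IsAffineDevelopment.contMDiff (hD : IsAffineDevelopment n π D)
    (hπ : IsLocalDiffeomorph (𝓘𝔼 n) (𝓘𝔼 n) ∞ π) : ContMDiff (𝓘𝔼 n) (𝓘𝔼 n) ∞ D := by
  intro x₀
  have := isManifold_of_affineGroupoid (n := n) (M := M)
  obtain ⟨A, hA⟩ := hD x₀
  have hAs : ContDiff ℝ ∞ A :=
    (⟨A.toAffineMap, AffineMap.continuous_of_finiteDimensional _⟩ : 𝔼 n →ᴬ[ℝ] 𝔼 n).contDiff
  have hκ : ContMDiffAt (𝓘𝔼 n) (𝓘𝔼 n) ∞ (chartAt (𝔼 n) (π x₀)) (π x₀) :=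
    contMDiffAt_of_mem_maximalAtlas (IsManifold.chart_mem_maximalAtlas _) (mem_chart_source _ _)
  exact (hAs.contMDiff.contMDiffAt.comp x₀ (hκ.comp x₀ (hπ.contMDiff x₀))).congr_of_eventuallyEq hA

theorem IsAffineDevelopment.mfderiv_eq (hD : IsAffineDevelopment n π D)
    (hπ : IsLocalDiffeomorph (𝓘𝔼 n) (𝓘𝔼 n) ∞ π) (x₀ : N) :
    ∃ A : 𝔼 n ≃L[ℝ] 𝔼 n, ∀ᶠ x in 𝓝 x₀, ∀ v : TangentSpace (𝓘𝔼 n) x,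
      mfderiv (𝓘𝔼 n) (𝓘𝔼 n) D x v =
        A (mfderiv (𝓘𝔼 n) (𝓘𝔼 n) (chartAt (𝔼 n) (π x₀)) (π x)
          (mfderiv (𝓘𝔼 n) (𝓘𝔼 n) π x v)) := by
  have := isManifold_of_affineGroupoid (n := n) (M := M)
  have := IsManifold.of_le (I := 𝓘𝔼 n) (M := M) (m := 1) (n := ∞) (by simp)
  obtain ⟨A, hA⟩ := hD x₀
  refine ⟨A.linear.toContinuousLinearEquiv, ?_⟩
  filter_upwards [eventually_eventually_nhds.2 hA,
    hπ.contMDiff.continuous.continuousAt.eventually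
      ((chartAt (𝔼 n) (π x₀)).open_source.mem_nhds (mem_chart_source _ _))] with x hx hxs v
  have hκ : MDifferentiableAt (𝓘𝔼 n) (𝓘𝔼 n) (chartAt (𝔼 n) (π x₀)) (π x) :=
    mdifferentiableAt_atlas (chart_mem_atlas _ _) hxs
  have hAd (z : 𝔼 n) :
      HasMFDerivAt (𝓘𝔼 n) (𝓘𝔼 n) A z (A.linear.toContinuousLinearEquiv : 𝔼 n →L[ℝ] 𝔼 n) :=
    ((⟨A.toAffineMap, AffineMap.continuous_of_finiteDimensional _⟩ :
      𝔼 n →ᴬ[ℝ] 𝔼 n).hasFDerivAt).hasMFDerivAt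
  have h := (hAd _).comp x
    (hκ.hasMFDerivAt.comp x (hπ.mdifferentiable (by simp) x).hasMFDerivAt)
  rw [(h.congr_of_eventuallyEq hx).mfderiv]
  rfl

theorem IsAffineDevelopment.bijective_mfderiv (hD : IsAffineDevelopment n π D)
    (hπ : IsLocalDiffeomorph (𝓘𝔼 n) (𝓘𝔼 n) ∞ π) (x : N) :
    Function.Bijective (mfderiv (𝓘𝔼 n) (𝓘𝔼 n) D x) := by
  have := isManifold_of_affineGroupoid (n := n) (M := M)
  have := IsManifold.of_le (I := 𝓘𝔼 n) (M := M) (m := 1) (n := ∞) (by simp)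
  obtain ⟨A, hA⟩ := hD.mfderiv_eq hπ x
  have h1 : Function.Bijective (mfderiv (𝓘𝔼 n) (𝓘𝔼 n) (chartAt (𝔼 n) (π x)) (π x)) :=
    (mdifferentiable_chart (I := 𝓘𝔼 n) (π x)).mfderiv_bijective (mem_chart_source _ _)
  have h2 : Function.Bijective (mfderiv (𝓘𝔼 n) (𝓘𝔼 n) π x) := by
    rw [← hπ.mfderivToContinuousLinearEquiv_coe (by simp)]
    exact (hπ.mfderivToContinuousLinearEquiv (by simp) x).bijective
  convert! A.bijective.comp (h1.comp h2)
  funext v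
  exact hA.self_of_nhds v

/-- The differential at `x` of a development, as an isomorphism `T_x N ≃ ℝⁿ`. These isomorphisms
form the global parallel frame of `N`. -/
def IsAffineDevelopment.frame (hD : IsAffineDevelopment n π D)
    (hπ : IsLocalDiffeomorph (𝓘𝔼 n) (𝓘𝔼 n) ∞ π) (x : N) :
    TangentSpace (𝓘𝔼 n) x ≃ₗ[ℝ] 𝔼 n :=
  LinearEquiv.ofBijective (M₂ := 𝔼 n) (mfderiv (𝓘𝔼 n) (𝓘𝔼 n) D x).toLinearMap
    (hD.bijective_mfderiv hπ x)

/-- In the frame of a development, the covariant derivative along a curve is the ordinary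
derivative. -/
theorem IsAffineDevelopment.hasPullbackCovDerivAlong_iff (hD : IsAffineDevelopment n π D)
    (hπ : IsLocalDiffeomorph (𝓘𝔼 n) (𝓘𝔼 n) ∞ π) {c : ℝ → TangentBundle (𝓘𝔼 n) N} {s : Set ℝ}
    {t : ℝ} (hc : ContinuousWithinAt (fun r => (c r).proj) s t)
    (w : TangentSpace (𝓘𝔼 n) (c t).proj) :
    HasPullbackCovDerivAlong π c s t w ↔
      HasDerivWithinAt (fun r => hD.frame hπ (c r).proj (c r).2)
        (hD.frame hπ (c t).proj w) s t := by
  obtain ⟨A, hA⟩ := hD.mfderiv_eq hπ (c t).proj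
  have hAt := hA.self_of_nhds
  let g : ℝ → 𝔼 n := fun r => mfderiv (𝓘𝔼 n) (𝓘𝔼 n) (chartAt (𝔼 n) (π (c t).proj)) (π (c r).proj)
    (mfderiv (𝓘𝔼 n) (𝓘𝔼 n) π (c r).proj (c r).2)
  let w' : 𝔼 n := mfderiv (𝓘𝔼 n) (𝓘𝔼 n) (chartAt (𝔼 n) (π (c t).proj)) (π (c t).proj)
    (mfderiv (𝓘𝔼 n) (𝓘𝔼 n) π (c t).proj w)
  have hw : hD.frame hπ (c t).proj w = A w' := hAt w
  have hev : (fun r => hD.frame hπ (c r).proj (c r).2) =ᶠ[𝓝[s] t] fun r => A (g r) := by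
    filter_upwards [hc.eventually hA] with r hr
    exact hr _
  have hev' : hD.frame hπ (c t).proj (c t).2 = A (g t) := hAt _
  change HasDerivWithinAt g w' s t ↔ _
  rw [hw]
  constructor
  · intro h
    exact ((A : 𝔼 n →L[ℝ] 𝔼 n).hasFDerivAt.comp_hasDerivWithinAt t h).congr_of_eventuallyEq
      hev hev'
  · intro h
    have h1 : HasDerivWithinAt (fun r => A (g r)) (A w') s t :=
      h.congr_of_eventuallyEq hev.symm hev'.symm
    simpa [Function.comp_def] using
      (A.symm : 𝔼 n →L[ℝ] 𝔼 n).hasFDerivAt.comp_hasDerivWithinAt t h1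

/-- A linear map is the parallel transport along a curve precisely when it respects the frame of a
development. In particular the transport does not depend on the curve. -/
theorem IsAffineDevelopment.isTransportAlong_iff (hD : IsAffineDevelopment n π D)
    (hπ : IsLocalDiffeomorph (𝓘𝔼 n) (𝓘𝔼 n) ∞ π) {γ : ℝ → N} (hγ : ContinuousOn γ (Icc 0 1))
    {p q : N} (hp : γ 0 = p) (hq : γ 1 = q)
    (L : TangentSpace (𝓘𝔼 n) p →ₗ[ℝ] TangentSpace (𝓘𝔼 n) q) :
    IsTransportAlong π γ L ↔ ∀ v, hD.frame hπ q (L v) = hD.frame hπ p v := by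
  have hcov : ∀ c : ℝ → TangentBundle (𝓘𝔼 n) N, (∀ t ∈ Icc (0 : ℝ) 1, (c t).proj = γ t) →
      ∀ t ∈ Icc (0 : ℝ) 1, (HasPullbackCovDerivAlong π c (Icc 0 1) t 0 ↔
        HasDerivWithinAt (fun r => hD.frame hπ (c r).proj (c r).2) 0 (Icc 0 1) t) := by
    intro c hc t ht
    rw [hD.hasPullbackCovDerivAlong_iff hπ ((hγ t ht).congr hc (hc t ht)), map_zero]
  constructor
  · intro h v
    obtain ⟨c, hc, h0, h1⟩ := h v
    have hder := fun t ht => (hcov c (fun t ht => (hc t ht).1) t ht).1 (hc t ht).2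
    let f : TangentBundle (𝓘𝔼 n) N → 𝔼 n := fun X => hD.frame hπ X.proj X.2
    have hconst : f (c 1) = f (c 0) := constant_of_derivWithin_zero
      (fun t ht => (hder t ht).differentiableWithinAt)
      (fun t ht => (hder t (Ico_subset_Icc_self ht)).derivWithin
        (uniqueDiffOn_Icc zero_lt_one t (Ico_subset_Icc_self ht))) 1 (right_mem_Icc.2 zero_le_one)
    rw [h0, h1] at hconst
    exact hconst
  · intro h v
    subst hp hq
    refine ⟨fun r => ⟨γ r, (hD.frame hπ (γ r)).symm (hD.frame hπ (γ 0) v)⟩, fun t ht => ⟨rfl, ?_⟩,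
      by simp, by simp [← h v]⟩
    rw [hcov _ (fun _ _ => rfl) t ht]
    simpa using hasDerivWithinAt_const t (Icc (0 : ℝ) 1) (hD.frame hπ (γ 0) v)

theorem IsAffineDevelopment.frame_parallelTransport (hD : IsAffineDevelopment n π D)
    (hπ : IsLocalDiffeomorph (𝓘𝔼 n) (𝓘𝔼 n) ∞ π) {p q : N}
    (hpq : ∃ γ : ℝ → N, IsCurve (n := n) p q γ) (v : TangentSpace (𝓘𝔼 n) p) :
    hD.frame hπ q (parallelTransport π p q v) = hD.frame hπ p v := by
  obtain ⟨γ, hγ⟩ := hpq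
  have hex : ∃ L : TangentSpace (𝓘𝔼 n) p →ₗ[ℝ] TangentSpace (𝓘𝔼 n) q,
      ∃ γ : ℝ → N, IsCurve (n := n) p q γ ∧ IsTransportAlong π γ L :=
    ⟨(hD.frame hπ p ≪≫ₗ (hD.frame hπ q).symm).toLinearMap, γ, hγ,
      (hD.isTransportAlong_iff hπ hγ.2.2.1 hγ.1 hγ.2.1 _).2 fun v => by simp⟩
  obtain ⟨δ, hδ, hL⟩ := Classical.epsilon_spec hex
  exact (hD.isTransportAlong_iff hπ hδ.2.2.1 hδ.1 hδ.2.1 _).1 hL v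

end Transport

/-! ### Piecewise smooth curves -/

section Curves

variable {n : ℕ} {N : Type*} [TopologicalSpace N] [ChartedSpace (𝔼 n) N]

theorem exists_nhds_forall_exists_contMDiffOn_segment [IsManifold (𝓘𝔼 n) ∞ N] (x₀ : N) :
    ∃ U ∈ 𝓝 x₀, ∀ x ∈ U, ∀ y ∈ U, ∃ σ : ℝ → N, σ 0 = x ∧ σ 1 = y ∧
      ContMDiffOn 𝓘(ℝ, ℝ) (𝓘𝔼 n) 1 σ (Icc 0 1) := by
  have := IsManifold.of_le (I := 𝓘𝔼 n) (M := N) (m := 1) (n := ∞) (by simp)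
  let κ := chartAt (𝔼 n) x₀
  obtain ⟨r, hr, hball⟩ := Metric.isOpen_iff.1 κ.open_target _ (mem_chart_target (𝔼 n) x₀)
  refine ⟨κ.source ∩ κ ⁻¹' Metric.ball (κ x₀) r, inter_mem (chart_source_mem_nhds _ _)
    ((κ.continuousAt (mem_chart_source _ _)).preimage_mem_nhds (Metric.ball_mem_nhds _ hr)),
    fun x hx y hy => ⟨fun t => κ.symm (AffineMap.lineMap (κ x) (κ y) t), ?_, ?_, ?_⟩⟩
  · simpa using κ.left_inv hx.1
  · simpa using κ.left_inv hy.1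
  · have hline : ContDiff ℝ 1 fun t : ℝ => AffineMap.lineMap (κ x) (κ y) t := by
      simp only [AffineMap.lineMap_apply_module]
      fun_prop
    exact (contMDiffOn_chart_symm (I := 𝓘𝔼 n) (x := x₀)).comp hline.contMDiff.contMDiffOn
      fun t ht => hball ((convex_ball (κ x₀) r).lineMap_mem hx.2 hy.2 ht)

theorem IsCurve.refl (p : N) : IsCurve (n := n) p p fun _ => p :=
  ⟨rfl, rfl, continuousOn_const, 1, fun i => i, Nat.mono_cast, by simp, by simp,
    fun _ _ => contMDiffOn_const⟩

/-- A piecewise `C¹` curve may be prolonged by a further `C¹` piece. -/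
theorem IsCurve.exists_extend {p q r : N} {γ σ : ℝ → N} (hγ : IsCurve (n := n) p q γ)
    (h0 : σ 0 = q) (h1 : σ 1 = r) (hσ : ContMDiffOn 𝓘(ℝ, ℝ) (𝓘𝔼 n) 1 σ (Icc 0 1)) :
    ∃ δ : ℝ → N, IsCurve (n := n) p r δ := by
  obtain ⟨hp, hq, hc, k, τ, hτ, hτ0, hτk, hs⟩ := hγ
  let δ : ℝ → N := fun t => if t ≤ 1 / 2 then γ (2 * t) else σ (2 * t - 1)
  have hδ₁ : EqOn δ (fun t => γ (2 * t)) (Iic (1 / 2)) := fun t ht => if_pos ht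
  have hδ₂ : EqOn δ (fun t => σ (2 * t - 1)) (Ici (1 / 2)) := by
    intro t ht
    rcases (mem_Ici.1 ht).eq_or_lt with rfl | h
    · have : δ (1 / 2) = γ (2 * (1 / 2)) := if_pos le_rfl
      rw [this]
      norm_num [hq, h0]
    · exact if_neg h.not_ge
  have hδσ : ContMDiffOn 𝓘(ℝ, ℝ) (𝓘𝔼 n) 1 δ (Icc (1 / 2) 1) := by
    refine ContMDiffOn.congr (f := fun t => σ (2 * t - 1)) ?_ fun t ht => hδ₂ ht.1
    refine hσ.comp (f := fun t => 2 * t - 1) (ContDiff.contMDiff (by fun_prop)).contMDiffOn ?_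
    intro t ht
    constructor <;> linarith [ht.1, ht.2]
  refine ⟨δ, ?_, ?_, ?_, k + 1, fun i => if i ≤ k then τ i / 2 else 1, ?_, ?_, ?_, ?_⟩
  · rw [hδ₁ (by simp)]
    simpa using hp
  · rw [hδ₂ (by norm_num : (1 : ℝ) ∈ Ici (1 / 2))]
    norm_num [h1]
  · rw [← Icc_union_Icc_eq_Icc (b := 1 / 2) (by norm_num) (by norm_num)]
    refine ContinuousOn.union_of_isClosed ?_ hδσ.continuousOn isClosed_Icc isClosed_Icc
    refine ContinuousOn.congr (f := fun t => γ (2 * t)) ?_ fun t ht => hδ₁ ht.2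
    refine hc.comp (by fun_prop) fun t ht => ?_
    constructor <;> linarith [ht.1, ht.2]
  · refine monotone_nat_of_le_succ fun i => ?_
    rcases lt_trichotomy i k with h | rfl | h
    · rw [if_pos h.le, if_pos (by omega)]
      linarith [hτ i.le_succ]
    · rw [if_pos le_rfl, if_neg (by omega), hτk]
      norm_num
    · rw [if_neg (by omega), if_neg (by omega)]
  · simp [hτ0]
  · simp
  · intro i hi
    rcases Nat.lt_succ_iff_lt_or_eq.1 hi with h | rfl
    · beta_reduce
      rw [if_pos h.le, if_pos (by omega)]
      have hle : τ (i + 1) ≤ 1 := hτk ▸ hτ h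
      refine ContMDiffOn.congr (f := fun t => γ (2 * t)) ?_
        fun t ht => hδ₁ (by rw [mem_Iic]; linarith [ht.2])
      refine (hs i h).comp (f := fun t => 2 * t) (ContDiff.contMDiff (by fun_prop)).contMDiffOn ?_
      intro t ht
      constructor <;> linarith [ht.1, ht.2]
    · beta_reduce
      rw [if_pos le_rfl, if_neg (by omega), hτk]
      exact hδσ

theorem exists_isCurve [IsManifold (𝓘𝔼 n) ∞ N] [PreconnectedSpace N] (p q : N) :
    ∃ γ : ℝ → N, IsCurve (n := n) p q γ := by
  let S : Set N := {x | ∃ γ : ℝ → N, IsCurve (n := n) p x γ}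
  have key : ∀ x₀ : N, ∃ U ∈ 𝓝 x₀, ∀ x ∈ U, ∀ y ∈ U, x ∈ S → y ∈ S := by
    intro x₀
    obtain ⟨U, hU, h⟩ := exists_nhds_forall_exists_contMDiffOn_segment (n := n) x₀
    refine ⟨U, hU, fun x hx y hy hxS => ?_⟩
    obtain ⟨γ, hγ⟩ := hxS
    obtain ⟨σ, h0, h1, hσ⟩ := h x hx y hy
    exact hγ.exists_extend h0 h1 hσ
  have hopen : IsOpen S := isOpen_iff_mem_nhds.2 fun x hx => by
    obtain ⟨U, hU, h⟩ := key x
    exact mem_of_superset hU fun y hy => h x (mem_of_mem_nhds hU) y hy hx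
  have hclosed : IsClosed S := isOpen_compl_iff.1 <| isOpen_iff_mem_nhds.2 fun x hx => by
    obtain ⟨U, hU, h⟩ := key x
    exact mem_of_superset hU fun y hy hyS => hx (h y hy x (mem_of_mem_nhds hU) hyS)
  have huniv : S = univ := IsClopen.eq_univ ⟨hclosed, hopen⟩ ⟨p, _, IsCurve.refl p⟩
  exact huniv.ge (mem_univ q)

end Curves

/-! ### The integral formula for the developing map -/

section Integral

variable {n : ℕ} {N : Type*} [TopologicalSpace N] [ChartedSpace (𝔼 n) N]

theorem hasDerivAt_comp_of_mdifferentiableAt {D : N → 𝔼 n} {γ : ℝ → N} {t : ℝ}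
    (hD : MDifferentiableAt (𝓘𝔼 n) (𝓘𝔼 n) D (γ t)) (hγ : MDifferentiableAt 𝓘(ℝ, ℝ) (𝓘𝔼 n) γ t) :
    HasDerivAt (F := 𝔼 n) (D ∘ γ) (mfderiv (𝓘𝔼 n) (𝓘𝔼 n) D (γ t) (velocity γ t)) t := by
  let L : ℝ →L[ℝ] 𝔼 n :=
    (mfderiv (𝓘𝔼 n) (𝓘𝔼 n) D (γ t)).comp (mfderiv 𝓘(ℝ, ℝ) (𝓘𝔼 n) γ t)
  have h : HasFDerivAt (D ∘ γ) L t :=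
    hasMFDerivAt_iff_hasFDerivAt.1 (hD.hasMFDerivAt.comp t hγ.hasMFDerivAt)
  exact h.hasDerivAt

/-- The fundamental theorem of calculus along a piecewise `C¹` curve. -/
theorem IsCurve.integral_eq_sub {p q : N} {γ : ℝ → N} (hγ : IsCurve (n := n) p q γ)
    {D : N → 𝔼 n} (hD : ContMDiff (𝓘𝔼 n) (𝓘𝔼 n) ∞ D) {f' : ℝ → 𝔼 n}
    (hf' : ∀ t, f' t = mfderiv (𝓘𝔼 n) (𝓘𝔼 n) D (γ t) (velocity γ t)) :
    IntervalIntegrable f' MeasureTheory.volume 0 1 ∧ ∫ t in (0 : ℝ)..1, f' t = D q - D p := by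
  obtain ⟨hp, hq, hc, k, τ, hτ, hτ0, hτk, hs⟩ := hγ
  -- The velocity is a two-sided derivative, so that it is meaningful only inside the pieces; on
  -- each piece the integrand is compared below with the one-sided derivative, which is continuous.
  have hder : ∀ i < k, ∀ t ∈ Ioo (τ i) (τ (i + 1)), HasDerivAt (D ∘ γ) (f' t) t := by
    intro i hi t ht
    rw [hf']
    exact hasDerivAt_comp_of_mdifferentiableAt (hD.mdifferentiable (by simp) _)
      (((hs i hi).contMDiffAt (Icc_mem_nhds ht.1 ht.2)).mdifferentiableAt (by simp))
  have hint : IntervalIntegrable f' MeasureTheory.volume (τ 0) (τ k) := by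
    refine IntervalIntegrable.trans_iterate fun i hi => ?_
    rcases (hτ i.le_succ).eq_or_lt with h | h
    · rw [← Nat.succ_eq_add_one, ← h]
    have hsm : ContDiffOn ℝ 1 (D ∘ γ) (Icc (τ i) (τ (i + 1))) :=
      contMDiffOn_iff_contDiffOn.1 ((hD.of_le (by simp)).comp_contMDiffOn (hs i hi))
    have hcont := hsm.continuousOn_derivWithin (uniqueDiffOn_Icc h) le_rfl
    rw [← uIcc_of_le h.le] at hcont
    refine (hcont.intervalIntegrable (μ := MeasureTheory.volume)).congr_uIoo fun t ht => ?_
    rw [uIoo_of_le h.le] at ht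
    rw [uIcc_of_le h.le, derivWithin_of_mem_nhds (Icc_mem_nhds ht.1 ht.2)]
    exact (hder i hi t ht).deriv
  rw [hτ0, hτk] at hint
  refine ⟨hint, ?_⟩
  rw [← hp, ← hq]
  refine MeasureTheory.integral_eq_of_hasDerivAt_off_countable_of_le (D ∘ γ) f' zero_le_one
    (countable_range τ) (hD.continuous.comp_continuousOn hc) ?_ hint
  rintro t ⟨⟨ht0, ht1⟩, htτ⟩
  -- The piece containing `t` ends at the first partition point beyond `t`.
  classical
  have hex : ∃ j, t < τ j := ⟨k, by rw [hτk]; exact ht1⟩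
  obtain ⟨i, hi⟩ : ∃ i, Nat.find hex = i + 1 := by
    refine Nat.exists_eq_succ_of_ne_zero fun h => ?_
    have := Nat.find_spec hex
    rw [h, hτ0] at this
    linarith
  have h1 : t < τ (i + 1) := hi ▸ Nat.find_spec hex
  have h2 : τ i ≤ t := not_lt.1 (Nat.find_min hex (by omega))
  have h3 : Nat.find hex ≤ k := Nat.find_min' hex (by rw [hτk]; exact ht1)
  exact hder i (by omega) t ⟨h2.lt_of_ne fun h => htτ ⟨i, h⟩, h1⟩

variable {M : Type*} [TopologicalSpace M] [ChartedSpace (𝔼 n) M] [HasGroupoid M (affineGroupoid n)]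
  {π : N → M} {D : N → 𝔼 n}

/-- In the frame of a development `D`, the developing map is `D` up to a translation. -/
theorem IsAffineDevelopment.frame_developingMap [IsManifold (𝓘𝔼 n) ∞ N] [PreconnectedSpace N]
    (hD : IsAffineDevelopment n π D) (hπ : IsLocalDiffeomorph (𝓘𝔼 n) (𝓘𝔼 n) ∞ π) (p q : N) :
    hD.frame hπ p (developingMap (n := n) π p q) = D q - D p := by
  have hcurve : ∀ γ : ℝ → N, IsCurve (n := n) p q γ →
      hD.frame hπ p (transportIntegral π p γ) = D q - D p := by
    intro γ hγ
    let Θ : 𝔼 n ≃ₗ[ℝ] 𝔼 n := hD.frame hπ p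
    let Ψ : 𝔼 n →L[ℝ] 𝔼 n := Θ.symm.toLinearMap.toContinuousLinearMap
    obtain ⟨hint, hval⟩ := hγ.integral_eq_sub (hD.contMDiff hπ)
      (f' := fun t => mfderiv (𝓘𝔼 n) (𝓘𝔼 n) D (γ t) (velocity γ t)) fun _ => rfl
    have heq : transportIntegral π p γ = Ψ (D q - D p) := by
      rw [← hval, ← Ψ.intervalIntegral_comp_comm hint]
      refine intervalIntegral.integral_congr (E := 𝔼 n) fun t _ => Θ.injective ?_
      exact (hD.frame_parallelTransport hπ (exists_isCurve _ _) _).trans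
        (Θ.apply_symm_apply _).symm
    rw [heq]
    exact Θ.apply_symm_apply _
  have hex : ∃ w : TangentSpace (𝓘𝔼 n) p,
      ∃ γ : ℝ → N, IsCurve (n := n) p q γ ∧ w = transportIntegral π p γ := by
    obtain ⟨γ, hγ⟩ := exists_isCurve (n := n) p q
    exact ⟨_, γ, hγ, rfl⟩
  obtain ⟨γ, hγ, h⟩ := Classical.epsilon_spec hex
  exact (congrArg (hD.frame hπ p) h).trans (hcurve γ hγ)

end Integral

/-! ### Deck transformations in the developing coordinates -/

section Deck

variable {n : ℕ} {M : Type*} [TopologicalSpace M] [ChartedSpace (𝔼 n) M]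
  {N : Type*} [TopologicalSpace N] {π : N → M} {D : N → 𝔼 n}

/-- A development is locally open, so that an affine map is determined by its values on it. -/
theorem IsAffineDevelopment.affineEquiv_eq (hD : IsAffineDevelopment n π D)
    (hπ : IsLocalHomeomorph π) {x₀ : N} {m m' : 𝔼 n ≃ᵃ[ℝ] 𝔼 n}
    (h : ∀ᶠ x in 𝓝 x₀, m (D x) = m' (D x)) : m = m' := by
  obtain ⟨A, hA⟩ := hD x₀
  have hAm : A.trans m = A.trans m' := by
    apply AffineEquiv.eq_of_eventuallyEq_chart (mem_chart_source (𝔼 n) (π x₀))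
    rw [← hπ.map_nhds_eq x₀, eventually_map]
    filter_upwards [h, hA] with x h1 h2
    rwa [h2] at h1
  ext1 v
  simpa using DFunLike.congr_fun hAm (A.symm v)

/-- A deck transformation acts in the coordinates of a development by an affine map: locally
because it preserves `π`, and globally because the affine map is locally constant. -/
theorem IsAffineDevelopment.exists_affineEquiv_deck [ConnectedSpace N]
    (hD : IsAffineDevelopment n π D) (hπ : IsLocalHomeomorph π) {φ : N ≃ₜ N}
    (hφ : IsDeckTransformation π φ) : ∃ m : 𝔼 n ≃ᵃ[ℝ] 𝔼 n, ∀ x, D (φ x) = m (D x) := by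
  have hloc : ∀ x₀, ∃ m : 𝔼 n ≃ᵃ[ℝ] 𝔼 n, ∀ᶠ x in 𝓝 x₀, D (φ x) = m (D x) := by
    intro x₀
    obtain ⟨A, hA⟩ := hD x₀
    obtain ⟨B, hB⟩ := hD (φ x₀)
    refine ⟨A.symm.trans B, ?_⟩
    filter_upwards [hA, φ.continuous.continuousAt.eventually hB] with x h1 h2
    rw [h2, h1, hφ, hφ]
    simp
  obtain ⟨p⟩ : Nonempty N := inferInstance
  obtain ⟨m, hm⟩ := hloc p
  let S : Set N := {x₀ | ∀ᶠ x in 𝓝 x₀, D (φ x) = m (D x)}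
  have hopen : IsOpen S := isOpen_iff_mem_nhds.2 fun x hx => eventually_eventually_nhds.2 hx
  have hclosed : IsClosed S := isOpen_compl_iff.1 <| isOpen_iff_mem_nhds.2 fun x hx => by
    obtain ⟨m', hm'⟩ := hloc x
    filter_upwards [eventually_eventually_nhds.2 hm'] with y hy hyS
    have : m' = m := by
      apply hD.affineEquiv_eq hπ (x₀ := y)
      filter_upwards [hy, hyS] with z h1 h2
      rw [← h1, ← h2]
    rw [this] at hm'
    exact hx hm'
  have huniv : S = univ := IsClopen.eq_univ ⟨hclosed, hopen⟩ ⟨p, hm⟩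
  refine ⟨m, fun x => ?_⟩
  have hx : x ∈ S := huniv.ge (mem_univ x)
  exact hx.self_of_nhds

variable [ChartedSpace (𝔼 n) N]

theorem IsDeckTransformation.mdifferentiableAt {φ : N ≃ₜ N} (hφ : IsDeckTransformation π φ)
    (hπ : IsLocalDiffeomorph (𝓘𝔼 n) (𝓘𝔼 n) ∞ π) (x : N) :
    MDifferentiableAt (𝓘𝔼 n) (𝓘𝔼 n) φ x := by
  -- Near `x`, the map `φ` is `π` followed by the local inverse of `π` at `φ x`.
  have h := hπ (φ x)
  have hinv : MDifferentiableAt (𝓘𝔼 n) (𝓘𝔼 n) h.localInverse (π x) := by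
    rw [← hφ x]
    exact h.localInverse_mdifferentiableAt (by simp)
  refine (hinv.comp x (hπ.mdifferentiable (by simp) x)).congr_of_eventuallyEq ?_
  filter_upwards [φ.continuous.continuousAt.eventually h.localInverse_eventuallyEq_left] with y hy
  rw [Function.comp_apply, ← hφ y]
  exact hy.symm

/-- In the frame of a development, `A_φ` is the linear part of the affine map by which `φ` acts
on the development. -/
theorem IsAffineDevelopment.frame_monodromyLinear [HasGroupoid M (affineGroupoid n)]
    [IsManifold (𝓘𝔼 n) ∞ N] [PreconnectedSpace N] (hD : IsAffineDevelopment n π D)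
    (hπ : IsLocalDiffeomorph (𝓘𝔼 n) (𝓘𝔼 n) ∞ π) {φ : N ≃ₜ N} (hφ : IsDeckTransformation π φ)
    {m : 𝔼 n ≃ᵃ[ℝ] 𝔼 n} (hm : ∀ x, D (φ x) = m (D x)) (p : N) (v : TangentSpace (𝓘𝔼 n) p) :
    hD.frame hπ p (monodromyLinear π φ p v) = m.linear (hD.frame hπ p v) := by
  have hDd : ∀ x, MDifferentiableAt (𝓘𝔼 n) (𝓘𝔼 n) D x :=
    (hD.contMDiff hπ).mdifferentiable (by simp)
  have hmd : HasMFDerivAt (𝓘𝔼 n) (𝓘𝔼 n) m (D p)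
      (m.linear.toContinuousLinearEquiv : 𝔼 n →L[ℝ] 𝔼 n) :=
    ((⟨m.toAffineMap, AffineMap.continuous_of_finiteDimensional _⟩ :
      𝔼 n →ᴬ[ℝ] 𝔼 n).hasFDerivAt).hasMFDerivAt
  have h1 := (hDd (φ p)).hasMFDerivAt.comp p (hφ.mdifferentiableAt hπ p).hasMFDerivAt
  have h2 := hmd.comp p (hDd p).hasMFDerivAt
  have h3 : D ∘ φ = m ∘ D := funext hm
  rw [h3] at h1
  exact (hD.frame_parallelTransport hπ (exists_isCurve _ _) _).trans
    (DFunLike.congr_fun (hasMFDerivAt_unique h1 h2) v)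

end Deck

end

theorem mainTheorem1 {n : ℕ}
    {M : Type*} [TopologicalSpace M] [T2Space M] [SecondCountableTopology M] [ConnectedSpace M]
    [ChartedSpace (EuclideanSpace ℝ (Fin n)) M] [HasGroupoid M (affineGroupoid n)]
    {N : Type*} [TopologicalSpace N] [SimplyConnectedSpace N]
    [ChartedSpace (EuclideanSpace ℝ (Fin n)) N]
    [IsManifold 𝓘(ℝ, EuclideanSpace ℝ (Fin n)) ∞ N]
    (π : N → M) (hcover : IsCoveringMap π)
    (hsmooth : IsLocalDiffeomorph 𝓘(ℝ, EuclideanSpace ℝ (Fin n))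
      𝓘(ℝ, EuclideanSpace ℝ (Fin n)) ∞ π)
    (φ : N ≃ₜ N) (hφ : IsDeckTransformation π φ) (p : N) :
    ∃ m : TangentSpace 𝓘(ℝ, EuclideanSpace ℝ (Fin n)) p ≃ᵃ[ℝ]
        TangentSpace 𝓘(ℝ, EuclideanSpace ℝ (Fin n)) p,
      (∀ q : N, developingMap (n := n) π p (φ q) = m (developingMap (n := n) π p q)) ∧
      ∀ v, m v = monodromyLinear π φ p v + developingMap (n := n) π p (φ p) := by
  have := ChartedSpace.locallyPathConnectedSpace (EuclideanSpace ℝ (Fin n)) N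
  obtain ⟨D, hD⟩ := exists_isAffineDevelopment (n := n) hcover.continuous
  obtain ⟨m, hm⟩ := hD.exists_affineEquiv_deck hcover.isLocalHomeomorph hφ
  let Θ := hD.frame hsmooth p
  -- The affine map `m` of `ℝⁿ`, conjugated by the frame at `p` and by the translation by `D p`.
  let mφ := (Θ ≪≫ₗ m.linear ≪≫ₗ Θ.symm).toAffineEquiv.trans
    (AffineEquiv.constVAdd ℝ _ (developingMap (n := n) π p (φ p)))
  have hmφ : ∀ v, mφ v = Θ.symm (m.linear (Θ v)) + developingMap (n := n) π p (φ p) :=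
    fun v => add_comm _ _
  have hdev : ∀ q, Θ (developingMap (n := n) π p q) = D q - D p :=
    hD.frame_developingMap hsmooth p
  refine ⟨mφ, fun q => Θ.injective ?_, fun v => ?_⟩
  · rw [hmφ, map_add, hdev, Θ.apply_symm_apply, hdev, hdev, hm, hm]
    have h := m.toAffineMap.linearMap_vsub (D q) (D p)
    simp only [vsub_eq_sub, AffineEquiv.linear_toAffineMap, AffineEquiv.coe_toAffineMap,
      LinearEquiv.coe_coe] at h
    rw [h]
    abel
  · rw [hmφ, ← hD.frame_monodromyLinear hsmooth hφ hm p v, Θ.symm_apply_apply]
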